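/- Theorem 4.6. Let $(M,\mathbf T)$ be a closed oriented triangulated pseudo 3-manifold: $M$ is obtained from a finite disjoint union of oriented Euclidean tetrahedra by identifying all their codimension-1 faces in pairs by orientation-reversing affine homeomorphisms (simplices need not be embedded in $M$). Let $E$ be its set of edges (edges of the disjoint tetrahedra modulo the identifications), $T$ its set of tetrahedra, and $\triangle$ and $\Box$ the sets of normal isotopy classes of normal triangles and normal quadrilaterals (four, respectively three, in each tetrahedron). For $e\in E$ and $q\in\Box$ let $i(q,e)\in\{0,1,2\}$ be the number of edges $e^*$ in the class $e$ that lie in the tetrahedron containing $q$ and are disjoint from $q$. Let $SAS(\mathbf T)$ be the set of all $x:\Box\to\mathbf S^1=\{z\in\mathbb C:|z|=1\}$ such that $\prod_{q\subset\sigma}x(q)=-1$ for every $\sigma\in T$ and $\prod_{q\in\Box}x(q)^{i(q,e)}=1$ for every $e\in E$. The volume of $x\in SAS(\mathbf T)$ is $\mathbf V(x)=\sum_{q\in\Box}\Lambda(\arg x(q))$, where $\Lambda(a)=-\int_0^a\ln|2\sin u|\,du$ (a function of period $\pi$). A point $x\in SAS(\mathbf T)$ is called non-smooth if $x(q)=\pm1$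 for some $q\in\Box$. Haken's normal surface equation for $x\in\mathbb R^\triangle\times\mathbb R^\Box$ requires, for each normal arc $a$ in each triangular face, $x(t)+x(q)=x(t')+x(q')$, where $t,q$ and $t',q'$ are the normal triangle and quadrilateral having $a$ as an edge on the two sides of that face. A 2-quad-type solution is a solution $x$ for which exactly one or two of the coordinates $x(q)$, $q\in\Box$, are non-zero. If $\mathbf V:SAS(\mathbf T)\to\mathbb R$ has a maximum point that is non-smooth, then there exist three distinct 2-quad-type solutions $x_1,x_2,x_3$ of Haken's equation and three distinct quadrilaterals $q_1,q_2,q_3\in\Box$ in one tetrahedron such that $x_i(q_i)\neq0$ for $i=1,2,3$. -/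

import Mathlib

/-!
Closed triangulated pseudo 3-manifolds are given by gluing data.  `T` is the (finite) set of
tetrahedra, the vertices of each tetrahedron are labelled by `Fin 4`, and face `i` of a tetrahedron
is the face opposite to vertex `i`.  An affine homeomorphism between two triangular faces is the
same thing as a bijection between their vertices.
-/

/-- Identification in pairs of all faces of a collection `T` of disjoint tetrahedra.
Face `i` of `σ` is identified with face `glue σ i i` of the tetrahedron `adj σ i`, and a vertex
`v ≠ i` of that face is identified with the vertex `glue σ i v`.  (The permutation `glue σ i` is
the vertex bijection of the two faces, extended by sending the vertex opposite to the first face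
to the vertex opposite to the second one.)  No face is identified with itself, but two faces of the
same tetrahedron may be identified. -/
structure FacePairing (T : Type*) where
  adj : T → Fin 4 → T
  glue : T → Fin 4 → Equiv.Perm (Fin 4)
  adj_adj : ∀ σ i, adj (adj σ i) (glue σ i i) = σ
  glue_glue : ∀ σ i, glue (adj σ i) (glue σ i i) = (glue σ i)⁻¹
  ne_self : ∀ σ i, (adj σ i, glue σ i i) ≠ (σ, i)

/-- The edges of the disjoint tetrahedra: a tetrahedron and two of its vertices. -/
abbrev TetEdge (T : Type*) : Type _ := T × {s : Finset (Fin 4) // s.card = 2}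

/-- Normal triangle types: a tetrahedron and the vertex that the triangle cuts off. -/
abbrev NormalTriangle (T : Type*) : Type _ := T × Fin 4

/-- Normal quadrilateral types: `(σ, 0)`, `(σ, 1)`, `(σ, 2)` are the quadrilaterals in `σ`
separating the vertices as `01|23`, `02|13`, `03|12` respectively. -/
abbrev NormalQuad (T : Type*) : Type _ := T × Fin 3

/-- The quadrilateral number `q` does not separate the vertices `a` and `b` of its tetrahedron. -/
def SameSide (q : Fin 3) (a b : Fin 4) : Prop :=
  (a = 0 ∨ a = q.succ) ↔ (b = 0 ∨ b = q.succ)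

instance (q : Fin 3) (a b : Fin 4) : Decidable (SameSide q a b) := by
  unfold SameSide; infer_instance

/-- The normal arc cutting off the vertex `v` in face `i` (where `v ≠ i`) is an edge of the
quadrilateral number `q`: `q` separates `v` from the two other vertices of that face. -/
def QuadHasArc (q : Fin 3) (i v : Fin 4) : Prop :=
  ∀ u, u ≠ i → u ≠ v → ¬ SameSide q v u

instance (q : Fin 3) (i v : Fin 4) : Decidable (QuadHasArc q i v) := by
  unfold QuadHasArc; infer_instance

/-- Each normal arc is an edge of exactly one quadrilateral type of a given tetrahedron. -/
theorem exists_unique_quadHasArc : ∀ i v : Fin 4, v ≠ i →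
    ∃ q : Fin 3, QuadHasArc q i v ∧ ∀ q', QuadHasArc q' i v → q' = q := by
  decide

open Classical in
/-- `i(e*, q)` for an edge `e*` of the disjoint tetrahedra: it is `1` if `e*` and `q` lie in the
same tetrahedron and are disjoint, and `0` otherwise. -/
noncomputable def tetEdgeIndex {T : Type*} (e : TetEdge T) (q : NormalQuad T) : ℕ :=
  if e.1 = q.1 ∧ ∀ a ∈ e.2.1, ∀ b ∈ e.2.1, SameSide q.2 a b then 1 else 0

/-- The Lobachevsky function. -/
noncomputable def lobachevsky (x : ℝ) : ℝ :=
  -∫ u in (0 : ℝ)..x, Real.log |2 * Real.sin u|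

/-- The function on the circle induced by the Lobachevsky function; since the latter has period
`π`, the choice of the argument does not matter. -/
noncomputable def circleLobachevsky (z : Circle) : ℝ :=
  lobachevsky (Complex.arg (z : ℂ))

namespace FacePairing

variable {T : Type*} (τ : FacePairing T)

/-- `o` orients the tetrahedra (`o σ` is the sign of the vertex order `0, 1, 2, 3` of `σ`) so that
all face identifications are orientation reversing for the induced orientations of the faces. -/
def IsOrientation (o : T → ℤˣ) : Prop :=
  ∀ σ i, o (τ.adj σ i) * o σ * Equiv.Perm.sign (τ.glue σ i) = -1

/-- An edge contained in some face is identified with its image under the gluing of that face. -/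
def EdgeGlue (e e' : TetEdge T) : Prop :=
  ∃ i, i ∉ e.2.1 ∧ e'.1 = τ.adj e.1 i ∧ e'.2.1 = e.2.1.map (τ.glue e.1 i).toEmbedding

/-- The edges of the triangulation: classes of `TetEdge T` under the equivalence relation
generated by the face gluings. -/
def Edge : Type _ := Quot τ.EdgeGlue

open Classical in
/-- The index `i(e, q)`: the sum of `i(e*, q)` over all `e*` in the class `e`. -/
noncomputable def index [Fintype T] (e : τ.Edge) (q : NormalQuad T) : ℕ :=
  ∑ e' : TetEdge T, if (Quot.mk τ.EdgeGlue e' : τ.Edge) = e then tetEdgeIndex e' q else 0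

/-- `SAS`, the set of all circle-valued angle structures (with trivial curvature). -/
def SAS [Fintype T] : Set (NormalQuad T → Circle) :=
  {x | (∀ σ : T, ∏ k : Fin 3, (x (σ, k) : ℂ) = -1) ∧
    ∀ e : τ.Edge, ∏ q : NormalQuad T, x q ^ τ.index e q = 1}

/-- `x = (triangle coordinates, quadrilateral coordinates)` solves Haken's normal surface
equation: for each normal arc (in face `i` of `σ`, cutting off the vertex `v`) the sum of the two
coordinates of the normal disks having this arc as an edge is the same on the two sides. -/
def IsHakenSolution (x : (NormalTriangle T → ℝ) × (NormalQuad T → ℝ)) : Prop :=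
  ∀ (σ : T) (i v : Fin 4), v ≠ i → ∀ q q' : Fin 3,
    QuadHasArc q i v → QuadHasArc q' (τ.glue σ i i) (τ.glue σ i v) →
    x.1 (σ, v) + x.2 (σ, q) = x.2 (τ.adj σ i, q') + x.1 (τ.adj σ i, τ.glue σ i v)

/-- A solution to Haken's equation with exactly one or two non-zero quadrilateral coordinates. -/
def IsTwoQuadSolution (x : (NormalTriangle T → ℝ) × (NormalQuad T → ℝ)) : Prop :=
  τ.IsHakenSolution x ∧
    ({q : NormalQuad T | x.2 q ≠ 0}.ncard = 1 ∨ {q : NormalQuad T | x.2 q ≠ 0}.ncard = 2)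

end FacePairing

/-- The volume of a circle-valued angle structure. -/
noncomputable def angleVolume {T : Type*} [Fintype T] (x : NormalQuad T → Circle) : ℝ :=
  ∑ q, circleLobachevsky (x q)

/-- The non-smooth points for the volume: by definition, those with some angle equal to `±1`. -/
def IsNonSmooth {T : Type*} (x : NormalQuad T → Circle) : Prop :=
  ∃ q, (x q : ℂ) = 1 ∨ (x q : ℂ) = -1

/-!
Let `p` be a non-smooth maximum of the volume and call an angle of `p` flat if it is `±1`.  The
tangent space `tas` of `SAS` consists of the `v` with `∑ v = 0` in each tetrahedron and
`∑ v(q) i(q, e) = 0` for each edge.  Since `Λ(s) + s log |s|` is differentiable at `0`, the volume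
along `t ↦ p · exp (i t v)` varies by `-A(v) t log |t| + t (ℓ(v) - B(v)) + o(t)`, where
`A(v) = ∑ v(q)` and `B(v) = ∑ v(q) log |v(q)|` are sums over the flat `q` and `ℓ` is linear.
Maximality gives `A = 0` and then `B = ℓ` on `tas` (`exists_sum_mul_log_eq`).  But `B` is
singular along each hyperplane `v(q) = 0`, so the functional `v(q)` of a flat `q` is either zero on
`tas` or proportional to `v(r)` for another flat `r`
(`exists_eq_smul_of_sum_mul_log_linear`).  In both cases a combination of the coordinates `q` and `r`
vanishes on `tas`, hence is a combination of the equations defining `tas`.  The latter are the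
quadrilateral coordinates of the tetrahedral and edge solutions of Haken's equation
(`exists_isHakenSolution`), so each flat `q` lies in the support of a 2-quad-type solution
(`exists_solution_of_isFlat`).

It remains to have three flat angles in one tetrahedron.  If some tetrahedron has two of them, the
third is flat too.  Otherwise take a flat `q` in `σ` and its solution, with quadrilateral
coordinates `y` supported in `{q, r}`.  Rotating `y` in each oriented tetrahedron gives a tangent
vector `v ∈ tas` (`rotate_mem_tas`; this is the duality of Neumann and Zagier).  It
vanishes at `q` and `r` and on all tetrahedra other than those of `q` and `r`, but not
at the other two angles of `σ`.  A tetrahedron with a flat angle has volume zero, whatever its other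
angles are, so the flow along `v` preserves the volume; it is stopped when a second angle
of `σ`, hence also the third, becomes flat (`exists_max_all_isFlat`).
-/

/-! ### The Lobachevsky function -/

theorem intervalIntegrable_log_abs_two_mul_sin (a b : ℝ) :
    IntervalIntegrable (fun u => Real.log |2 * Real.sin u|) MeasureTheory.volume a b := by
  have h : MeromorphicOn (fun u : ℝ => 2 * Real.sin u) (Set.uIcc a b) := fun u _ =>
    (AnalyticAt.meromorphicAt (by fun_prop))
  simpa [Real.norm_eq_abs] using h.intervalIntegrable_log_norm

theorem lobachevsky_neg (x : ℝ) : lobachevsky (-x) = -lobachevsky x := by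
  unfold lobachevsky
  have := intervalIntegral.integral_comp_neg (a := 0) (b := x)
    (fun u => Real.log |2 * Real.sin u|)
  simp only [Real.sin_neg, mul_neg, abs_neg, neg_zero] at this
  rw [this, intervalIntegral.integral_symm]

theorem lobachevsky_zero : lobachevsky 0 = 0 := by simp [lobachevsky]

theorem lobachevsky_pi : lobachevsky Real.pi = 0 := by
  unfold lobachevsky
  have h : ∫ u in (0 : ℝ)..Real.pi, Real.log |2 * Real.sin u| =
      ∫ u in (0 : ℝ)..Real.pi, (Real.log 2 + Real.log (Real.sin u)) := by
    rw [intervalIntegral.integral_of_le Real.pi_pos.le,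
      intervalIntegral.integral_of_le Real.pi_pos.le, MeasureTheory.integral_Ioc_eq_integral_Ioo,
      MeasureTheory.integral_Ioc_eq_integral_Ioo]
    refine MeasureTheory.setIntegral_congr_fun measurableSet_Ioo fun u hu => ?_
    have := Real.sin_pos_of_mem_Ioo hu
    simp only [Real.log_abs]
    rw [Real.log_mul two_ne_zero this.ne']
  rw [h, intervalIntegral.integral_add (by simp)
    (by simpa [Function.comp_def] using intervalIntegrable_log_sin (a := 0) (b := Real.pi)),
    integral_log_sin_zero_pi]
  simp
  ring

theorem lobachevsky_periodic : Function.Periodic lobachevsky Real.pi := by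
  intro x
  have hp : Function.Periodic (fun u => Real.log |2 * Real.sin u|) Real.pi := by
    intro u
    simp [Real.sin_add_pi]
  have h := hp.intervalIntegral_add_eq_add 0 x intervalIntegrable_log_abs_two_mul_sin
  have hpi := lobachevsky_pi
  unfold lobachevsky at *
  rw [zero_add] at h
  linarith

theorem hasDerivAt_lobachevsky {x : ℝ} (hx : Real.sin x ≠ 0) :
    HasDerivAt lobachevsky (-Real.log |2 * Real.sin x|) x := by
  refine (intervalIntegral.integral_hasDerivAt_right
    (intervalIntegrable_log_abs_two_mul_sin 0 x) ?_ ?_).neg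
  · exact Measurable.stronglyMeasurable (by fun_prop) |>.stronglyMeasurableAtFilter
  · exact ContinuousAt.log (by fun_prop) (by simpa using hx)

/-- The singularity of the Lobachevsky function at `0` is exactly that of `-s * log |s|`
(recall that `Real.log s` stands for `log |s|`). -/
theorem hasDerivAt_lobachevsky_add_mul_log :
    HasDerivAt (fun s => lobachevsky s + s * Real.log s) (1 - Real.log 2) 0 := by
  have hint : ∀ a b : ℝ, IntervalIntegrable
      (fun u => Real.log |2 * Real.sin u| - Real.log u) MeasureTheory.volume a b := fun a b =>
    (intervalIntegrable_log_abs_two_mul_sin a b).sub intervalIntegral.intervalIntegrable_log'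
  have heq : (fun s => lobachevsky s + s * Real.log s) =
      fun s => s - ∫ u in (0 : ℝ)..s, (Real.log |2 * Real.sin u| - Real.log u) := by
    funext s
    rw [intervalIntegral.integral_sub (intervalIntegrable_log_abs_two_mul_sin 0 s)
      intervalIntegral.intervalIntegrable_log', integral_log, lobachevsky]
    ring
  rw [heq]
  refine (hasDerivAt_id (0 : ℝ)).sub
    (intervalIntegral.integral_hasDerivAt_of_tendsto_ae_right (hint 0 0) ?_ ?_)
  · exact Measurable.stronglyMeasurable (by fun_prop) |>.stronglyMeasurableAtFilter
  · have hle : nhds (0 : ℝ) ⊓ MeasureTheory.ae MeasureTheory.volume ≤ nhdsWithin 0 {0}ᶜ :=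
      inf_le_inf_left _ (Filter.le_principal_iff.2 (MeasureTheory.Measure.ae_ne _ 0))
    refine Filter.Tendsto.mono_left ?_ hle
    have hc : ContinuousAt (fun u => Real.log 2 + Real.log (Real.sinc u)) 0 :=
      continuousAt_const.add (Real.continuous_sinc.continuousAt.log (by simp))
    have ht := hc.tendsto.mono_left (nhdsWithin_le_nhds (s := {0}ᶜ))
    simp only [Real.sinc_zero, Real.log_one, add_zero] at ht
    refine ht.congr' ?_
    have hne : ∀ᶠ u in nhdsWithin (0 : ℝ) {0}ᶜ, Real.sinc u ≠ 0 :=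
      (Real.continuous_sinc.continuousAt.eventually_ne (by simp)).filter_mono nhdsWithin_le_nhds
    filter_upwards [hne, self_mem_nhdsWithin] with u hu hu0
    have hsin : Real.sin u = Real.sinc u * u := by
      rw [Real.sinc_of_ne_zero hu0, div_mul_cancel₀ _ hu0]
    rw [Real.log_abs, hsin, Real.log_mul two_ne_zero (mul_ne_zero hu hu0), Real.log_mul hu hu0]
    ring

theorem circleLobachevsky_exp (θ : ℝ) : circleLobachevsky (Circle.exp θ) = lobachevsky θ := by
  obtain ⟨m, hm⟩ := Circle.exp_eq_exp.1 (Circle.exp_arg (Circle.exp θ))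
  unfold circleLobachevsky
  rw [hm, ← lobachevsky_periodic.int_mul (2 * m) θ]
  congr 1
  push_cast
  ring

theorem circleLobachevsky_inv (z : Circle) : circleLobachevsky z⁻¹ = -circleLobachevsky z := by
  rw [← Circle.exp_arg z, ← Circle.exp_neg, circleLobachevsky_exp, circleLobachevsky_exp,
    lobachevsky_neg]

theorem circleLobachevsky_neg (z : Circle) : circleLobachevsky (-z) = circleLobachevsky z := by
  have h : -z = Circle.exp (Complex.arg z + Real.pi) := by
    rw [Circle.exp_add, Circle.exp_arg]
    ext
    simp
  rw [h, circleLobachevsky_exp, lobachevsky_periodic, ← circleLobachevsky_exp, Circle.exp_arg]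

/-! ### Singularities of entropy-like sums -/

/-- If a sum `∑ fᵢ log |fᵢ|` over linear functionals `fᵢ` is itself linear on a subspace `W`, then
no `f_q` can be, on `W`, isolated up to scalars: the singularity of `f_q log |f_q|` along the
hyperplane `f_q = 0` has to be cancelled by another term, singular along the same hyperplane. -/
theorem exists_eq_smul_of_sum_mul_log_linear {E ι : Type*} [AddCommGroup E] [Module ℝ E]
    (W : Submodule ℝ E) (F : Finset ι) (f : ι → Module.Dual ℝ E) (ℓ : Module.Dual ℝ E)
    (h : ∀ v ∈ W, ∑ i ∈ F, f i v * Real.log (f i v) = ℓ v) {q : ι} (hq : q ∈ F) :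
    (∀ v ∈ W, f q v = 0) ∨ ∃ r ∈ F, r ≠ q ∧ ∃ c : ℝ, ∀ v ∈ W, f q v = c * f r v := by
  classical
  by_contra! hcon
  obtain ⟨⟨u, huW, hu⟩, hcon⟩ := hcon
  let G : Finset ι := {r ∈ F | r ≠ q ∧ ∃ v ∈ W, f r v ≠ 0}
  -- a point of the hyperplane `f_q = 0` which lies on no other singular hyperplane
  obtain ⟨w, hw, hwG⟩ := Module.Dual.exists_forall_mem_ne_zero_of_forall_exists
    (W ⊓ LinearMap.ker (f q)) (fun r : G => f r) (by
      rintro ⟨r, hr⟩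
      obtain ⟨hrF, hrq, v, hvW, hv⟩ := Finset.mem_filter.1 hr
      by_contra! hker
      have hz : ∀ x ∈ W, f r x * f q u = f q x * f r u := by
        intro x hx
        have := hker (f q u • x - f q x • u)
          ⟨W.sub_mem (W.smul_mem _ hx) (W.smul_mem _ huW), by simp [mul_comm]⟩
        simp only [map_sub, map_smul, smul_eq_mul] at this
        linarith
      have hru : f r u ≠ 0 := fun h0 => by
        have := hz v hvW
        rw [h0, mul_zero] at this
        exact (mul_ne_zero hv hu) this
      obtain ⟨x, hxW, hx⟩ := hcon r hrF hrq (f q u / f r u)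
      refine hx ?_
      have := hz x hxW
      field_simp
      linarith)
  have hwW : w ∈ W := hw.1
  have hwq : f q w = 0 := hw.2
  have hrest : DifferentiableAt ℝ (fun s : ℝ => ∑ r ∈ F.erase q,
      (f r w + s * f r u) * Real.log (f r w + s * f r u)) 0 := by
    refine DifferentiableAt.fun_sum fun r hr => ?_
    obtain ⟨hrq, hrF⟩ := Finset.mem_erase.1 hr
    by_cases hrG : ∃ v ∈ W, f r v ≠ 0
    · have hne : f r w ≠ 0 := hwG ⟨r, Finset.mem_filter.2 ⟨hrF, hrq, hrG⟩⟩
      have hd : DifferentiableAt ℝ (fun s : ℝ => f r w + s * f r u) 0 := by fun_prop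
      exact hd.mul (hd.log (by simpa using hne))
    · push Not at hrG
      simp [hrG w hwW, hrG u huW]
  have hline : ∀ s : ℝ, (f q u * s) * Real.log (f q u * s) = ℓ w + s * ℓ u -
      ∑ r ∈ F.erase q, (f r w + s * f r u) * Real.log (f r w + s * f r u) := by
    intro s
    have := h (w + s • u) (W.add_mem hwW (W.smul_mem s huW))
    rw [← Finset.add_sum_erase F _ hq] at this
    simp only [map_add, map_smul, smul_eq_mul, hwq, zero_add] at this
    rw [mul_comm (f q u)]
    linarith
  have hdiff : DifferentiableAt ℝ (fun s : ℝ => (f q u * s) * Real.log (f q u * s)) 0 := by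
    simp only [hline]
    exact DifferentiableAt.sub (by fun_prop) hrest
  refine Real.not_DifferentiableAt_log_mul_zero ?_
  have hd : DifferentiableAt ℝ (fun s : ℝ => (f q u)⁻¹ * s) 0 := by fun_prop
  have := DifferentiableAt.comp (g := fun s : ℝ => (f q u * s) * Real.log (f q u * s))
    (0 : ℝ) (by simpa using hdiff) hd
  refine this.congr_of_eventuallyEq (Filter.Eventually.of_forall fun s => ?_)
  simp [mul_inv_cancel_left₀ hu]

/-- For `A > 0` the bound would force `D` to have slope `-∞` at `0` from the right. -/
theorem nonpos_of_le_mul_mul_log {D : ℝ → ℝ} {K A : ℝ} (hD : HasDerivAt D K 0) (hD0 : D 0 = 0)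
    (h : ∀ t, D t ≤ A * (t * Real.log t)) : A ≤ 0 := by
  by_contra! hA
  have ht : Filter.Tendsto (fun t => t⁻¹ * D t) (nhdsWithin 0 (Set.Ioi 0)) (nhds K) := by
    have := hD.tendsto_slope_zero_right
    simpa [hD0] using this
  have hlog : Filter.Tendsto (fun t => A * Real.log t) (nhdsWithin 0 (Set.Ioi 0)) Filter.atBot :=
    Filter.Tendsto.const_mul_atBot hA Real.tendsto_log_nhdsGT_zero
  refine not_tendsto_nhds_of_tendsto_atBot (Filter.tendsto_atBot_mono' _ ?_ hlog) K ht
  filter_upwards [self_mem_nhdsWithin] with t (ht : 0 < t)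
  rw [inv_mul_le_iff₀ ht]
  linarith [h t]

/-! ### Tangential angle structures and Haken's equation -/

/-- The index of the quadrilateral type which does not separate the vertices `a ≠ b`
(the value for `a = b` is irrelevant). -/
def quadPairing (a b : Fin 4) : Fin 3 :=
  (![![0, 0, 1, 2], ![0, 0, 2, 1], ![1, 2, 0, 0], ![2, 1, 0, 0]] : Fin 4 → Fin 4 → Fin 3) a b

theorem quadHasArc_iff : ∀ (i v : Fin 4) (q : Fin 3), v ≠ i →
    (QuadHasArc q i v ↔ q = quadPairing v i) := by
  decide

/-- The sign of the permutation `(a, b, c, d)` of the vertices, where `c` is the vertex different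
from `a`, `b`, `d`; it is `0` if these are not distinct. -/
def orderSign (a b d : Fin 4) : ℤ :=
  let c : ℤ := 6 - a.val - b.val - d.val
  Int.sign ((b.val - a.val) * (c - a.val) * (d.val - a.val) * (c - b.val) * (d.val - b.val) *
    (d.val - c))

theorem orderSign_perm : ∀ (g : Equiv.Perm (Fin 4)) (a b d : Fin 4),
    orderSign (g a) (g b) (g d) = (Equiv.Perm.sign g : ℤ) * orderSign a b d := by
  decide +kernel

theorem orderSign_ne_zero : ∀ a b d : Fin 4, orderSign a b d ≠ 0 → a ≠ b ∧ a ≠ d ∧ b ≠ d := by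
  decide +kernel

theorem arc_coeff : ∀ (i v : Fin 4) (s : Finset (Fin 4)), v ≠ i → s.card = 2 →
    (if ∀ a ∈ s, ∀ b ∈ s, SameSide (quadPairing v i) a b then (1 : ℤ) else 0) -
      (if v ∈ s then 1 else 0) = if i ∈ s then 0 else if v ∈ s then -1 else 1 := by
  decide +kernel

theorem filter_sameSide : ∀ k : Fin 3,
    ({s : {s : Finset (Fin 4) // s.card = 2} | ∀ a ∈ s.1, ∀ b ∈ s.1, SameSide k a b} : Finset _) =
      {⟨{0, k.succ}, Finset.card_pair (Fin.succ_ne_zero k).symm⟩,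
        ⟨{(k + 1).succ, (k + 2).succ}, Finset.card_pair (by revert k; decide)⟩} := by
  decide +kernel

/-- Only the quadrilateral coordinates survive when the arc weights around the edges of one
tetrahedron are summed with signs; every edge contributes the difference of the two quadrilaterals
that meet it. -/
theorem sum_orderSign_mul (X : Fin 4 → Fin 4 → ℝ) (hX : ∀ a b, X a b = X b a) (t : Fin 4 → ℝ)
    (y : Fin 3 → ℝ) :
    ∑ a, ∑ b, ∑ d, (orderSign a b d : ℝ) * X a b * (t a + y (quadPairing a d)) =
      -2 * ∑ k : Fin 3, (X 0 k.succ + X (k + 1).succ (k + 2).succ) * (y (k + 1) - y (k + 2)) := by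
  simp only [Fin.sum_univ_four, Fin.sum_univ_three]
  have hpos : Int.sign 12 = 1 := rfl
  have hneg : Int.sign (-12) = -1 := rfl
  simp [orderSign, quadPairing, hpos, hneg]
  rw [hX 1 0, hX 2 0, hX 3 0, hX 2 1, hX 3 1, hX 3 2]
  ring

theorem sum_mul_tetEdgeIndex {T : Type*} [Fintype T] (β : TetEdge T → ℝ) (σ : T) (k : Fin 3) :
    ∑ e : TetEdge T, β e * tetEdgeIndex e (σ, k) =
      ∑ s : {s : Finset (Fin 4) // s.card = 2},
        if ∀ a ∈ s.1, ∀ b ∈ s.1, SameSide k a b then β (σ, s) else 0 := by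
  classical
  rw [Fintype.sum_prod_type, Finset.sum_eq_single σ]
  · refine Finset.sum_congr rfl fun s _ => ?_
    simp [tetEdgeIndex]
  · intro σ' _ h
    refine Finset.sum_eq_zero fun s _ => ?_
    simp [tetEdgeIndex, h]
  · simp

namespace FacePairing

variable {T : Type*} (τ : FacePairing T)

/-- The edge of the triangulation represented by an edge of a tetrahedron. -/
def edgeClass (e : TetEdge T) : τ.Edge :=
  Quot.mk τ.EdgeGlue e

variable {τ} in
theorem edgeClass_eq {e e' : TetEdge T} (h : τ.EdgeGlue e e') : τ.edgeClass e = τ.edgeClass e' :=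
  Quot.sound h

/-- Functions on the edges of the tetrahedra that are constant on the edges of the
triangulation. -/
def IsEdgeFunction (β : TetEdge T → ℝ) : Prop :=
  ∀ e e', τ.EdgeGlue e e' → β e = β e'

/-- The tangential angle structures: the tangent space of `SAS`. -/
def tas [Fintype T] : Submodule ℝ (NormalQuad T → ℝ) where
  carrier := {v | (∀ σ, ∑ k : Fin 3, v (σ, k) = 0) ∧
    ∀ e : τ.Edge, ∑ q, (τ.index e q : ℝ) * v q = 0}
  zero_mem' := by simp
  add_mem' {v w} hv hw := by
    refine ⟨fun σ => ?_, fun e => ?_⟩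
    · simp [Finset.sum_add_distrib, hv.1, hw.1]
    · simp [mul_add, Finset.sum_add_distrib, hv.2, hw.2]
  smul_mem' c v hv := by
    refine ⟨fun σ => ?_, fun e => ?_⟩
    · simp [← Finset.mul_sum, hv.1]
    · simp only [Pi.smul_apply, smul_eq_mul, mul_left_comm _ c]
      rw [← Finset.mul_sum, hv.2, mul_zero]

open Classical in
theorem index_eq_sum [Fintype T] (e : τ.Edge) (q : NormalQuad T) :
    (τ.index e q : ℝ) = ∑ e' : TetEdge T,
      (if τ.edgeClass e' = e then 1 else 0) * (tetEdgeIndex e' q : ℝ) := by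
  rw [index, Nat.cast_sum]
  refine Finset.sum_congr rfl fun e' _ => ?_
  by_cases h : τ.edgeClass e' = e
  · rw [if_pos (show Quot.mk τ.EdgeGlue e' = e from h), if_pos h, one_mul]
  · rw [if_neg (show ¬Quot.mk τ.EdgeGlue e' = e from h), if_neg h, zero_mul, Nat.cast_zero]

/-- Finite-dimensional duality: a functional vanishing on the tangential angle structures is a
combination of the equations defining them. -/
theorem exists_of_forall_tas [Fintype T] (y : NormalQuad T → ℝ)
    (h : ∀ v ∈ τ.tas, ∑ q, y q * v q = 0) :
    ∃ (a : T → ℝ) (β : TetEdge T → ℝ), τ.IsEdgeFunction β ∧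
      ∀ σ k, y (σ, k) = a σ + ∑ e, β e * tetEdgeIndex e (σ, k) := by
  classical
  let Φ : (NormalQuad T → ℝ) →ₗ[ℝ] Module.Dual ℝ (NormalQuad T → ℝ) :=
    { toFun := fun y => ∑ q, y q • LinearMap.proj q
      map_add' := fun y z => by simp [add_smul, Finset.sum_add_distrib]
      map_smul' := fun c y => by simp [Finset.smul_sum, smul_smul] }
  have hΦ : ∀ y v, Φ y v = ∑ q, y q * v q := fun y v => by simp [Φ]
  let row : T ⊕ TetEdge T → NormalQuad T → ℝ :=
    Sum.elim (fun σ q => if q.1 = σ then 1 else 0)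
      (fun e q => (τ.index (τ.edgeClass e) q : ℝ))
  have hmem : Φ y ∈ Submodule.span ℝ (Set.range fun j => Φ (row j)) := by
    refine mem_span_of_iInf_ker_le_ker fun v hv => ?_
    simp only [Submodule.mem_iInf, LinearMap.mem_ker, hΦ] at hv ⊢
    refine h v ⟨fun σ => ?_, fun e => ?_⟩
    · have := hv (Sum.inl σ)
      rw [Fintype.sum_prod_type_right] at this
      simpa [row] using this
    · obtain ⟨e, rfl⟩ := Quot.exists_rep e
      exact hv (Sum.inr e)
  obtain ⟨c, hc⟩ := (Submodule.mem_span_range_iff_exists_fun ℝ).1 hmem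
  refine ⟨fun σ => c (Sum.inl σ), fun e' => ∑ e : TetEdge T, c (Sum.inr e) *
    if τ.edgeClass e' = τ.edgeClass e then 1 else 0, ?_, ?_⟩
  · intro e e' hee
    simp only [edgeClass_eq hee]
  · intro σ k
    have hs : ∀ z, Φ z (Pi.single (σ, k) 1) = z (σ, k) := fun z => by
      simp [hΦ, Pi.single_apply]
    have := LinearMap.congr_fun hc (Pi.single (σ, k) 1)
    simp only [LinearMap.sum_apply, LinearMap.smul_apply, hs, smul_eq_mul] at this
    rw [← this, Fintype.sum_sum_type]
    congr 1
    · simp [row]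
    · simp only [Finset.sum_mul]
      rw [Finset.sum_comm]
      refine Finset.sum_congr rfl fun e _ => ?_
      simp only [row, Sum.elim_inr]
      rw [index_eq_sum, Finset.mul_sum]
      simp only [mul_assoc]

/-- The combinations of the equations of angle structures are the quadrilateral coordinates of
solutions of Haken's equation (sums of tetrahedral and edge solutions). -/
theorem exists_isHakenSolution [Fintype T] (a : T → ℝ) (β : TetEdge T → ℝ)
    (hβ : τ.IsEdgeFunction β) :
    ∃ x, τ.IsHakenSolution x ∧
      ∀ σ k, x.2 (σ, k) = a σ + ∑ e, β e * tetEdgeIndex e (σ, k) := by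
  classical
  let x : (NormalTriangle T → ℝ) × (NormalQuad T → ℝ) :=
    (fun p => -a p.1 - ∑ s : {s : Finset (Fin 4) // s.card = 2},
        if p.2 ∈ s.1 then β (p.1, s) else 0,
      fun p => a p.1 + ∑ e, β e * tetEdgeIndex e (p.1, p.2))
  -- the weight of an arc is a sum over the edges of its face
  have harc : ∀ σ (i v : Fin 4), v ≠ i → x.1 (σ, v) + x.2 (σ, quadPairing v i) =
      ∑ s : {s : Finset (Fin 4) // s.card = 2},
        ((if i ∈ s.1 then 0 else if v ∈ s.1 then -1 else 1 : ℤ) : ℝ) * β (σ, s) := by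
    intro σ i v hvi
    have hc : ∀ s : {s : Finset (Fin 4) // s.card = 2},
        ((if i ∈ s.1 then 0 else if v ∈ s.1 then -1 else 1 : ℤ) : ℝ) * β (σ, s) =
        (if ∀ a ∈ s.1, ∀ b ∈ s.1, SameSide (quadPairing v i) a b then β (σ, s) else 0) -
          if v ∈ s.1 then β (σ, s) else 0 := by
      intro s
      rw [← arc_coeff i v s.1 hvi s.2]
      push_cast
      rw [sub_mul, ite_mul, ite_mul, one_mul, zero_mul]
    simp only [hc, Finset.sum_sub_distrib, x, sum_mul_tetEdgeIndex]
    ring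
  refine ⟨x, ?_, fun σ k => rfl⟩
  intro σ i v hvi q q' hq hq'
  have hg : τ.glue σ i v ≠ τ.glue σ i i := fun h => hvi ((τ.glue σ i).injective h)
  rw [quadHasArc_iff _ _ _ hvi] at hq
  rw [quadHasArc_iff _ _ _ hg] at hq'
  subst hq hq'
  rw [harc σ i v hvi, add_comm, harc _ _ _ hg]
  refine Fintype.sum_equiv ((τ.glue σ i).finsetCongr.subtypeEquiv (by simp)) _ _ fun s => ?_
  by_cases his : i ∈ s.1
  · simp [his]
  · have : β (σ, s) = β (τ.adj σ i, (τ.glue σ i).finsetCongr.subtypeEquiv (by simp) s) :=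
      hβ _ _ ⟨i, his, rfl, rfl⟩
    rw [this]
    simp

variable {τ} in
theorem IsHakenSolution.smul {x : (NormalTriangle T → ℝ) × (NormalQuad T → ℝ)}
    (hx : τ.IsHakenSolution x) (c : ℝ) : τ.IsHakenSolution (c • x) := by
  intro σ i v hv q q' hq hq'
  have := hx σ i v hv q q' hq hq'
  simp only [Prod.smul_fst, Prod.smul_snd, Pi.smul_apply, smul_eq_mul]
  linear_combination c * this

/-- The rotation of quadrilateral coordinates inside each tetrahedron, in the direction given by
the orientation. -/
def rotate (o : T → ℤˣ) (y : NormalQuad T → ℝ) : NormalQuad T → ℝ := fun q =>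
  ((o q.1 : ℤ) : ℝ) * (y (q.1, q.2 + 1) - y (q.1, q.2 + 2))

/-- The passage across a face of a tetrahedron with three marked vertices, the last of which is
opposite to the face. -/
def cross (z : T × Fin 4 × Fin 4 × Fin 4) : T × Fin 4 × Fin 4 × Fin 4 :=
  (τ.adj z.1 z.2.2.2, τ.glue z.1 z.2.2.2 z.2.1, τ.glue z.1 z.2.2.2 z.2.2.1,
    τ.glue z.1 z.2.2.2 z.2.2.2)

theorem cross_involutive : Function.Involutive τ.cross := by
  rintro ⟨σ, a, b, d⟩
  simp [cross, τ.adj_adj, τ.glue_glue]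

/-- Rotated quadrilateral coordinates of a solution of Haken's equation are tangential angle
structures: around an edge of the triangulation, the differences of quadrilateral coordinates are
differences of arc weights, which telescope. -/
theorem rotate_mem_tas [Fintype T] {o : T → ℤˣ} (ho : τ.IsOrientation o)
    {x : (NormalTriangle T → ℝ) × (NormalQuad T → ℝ)} (hx : τ.IsHakenSolution x) :
    rotate o x.2 ∈ τ.tas := by
  classical
  refine ⟨fun σ => ?_, fun e => ?_⟩
  · rw [Fin.sum_univ_three]
    simp only [rotate]
    rw [show (1 + 1 : Fin 3) = 2 from rfl, show (1 + 2 : Fin 3) = 0 from rfl,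
      show (2 + 1 : Fin 3) = 0 from rfl, show (2 + 2 : Fin 3) = 1 from rfl, zero_add, zero_add]
    ring
  let χ : TetEdge T → ℝ := fun e' => if τ.edgeClass e' = e then 1 else 0
  have hχ : τ.IsEdgeFunction χ := fun e₁ e₂ h => by simp only [χ, edgeClass_eq h]
  let X : T → Fin 4 → Fin 4 → ℝ := fun σ a b =>
    if h : a ≠ b then χ (σ, ⟨{a, b}, Finset.card_pair h⟩) else 0
  have hX : ∀ σ a b, X σ a b = X σ b a := fun σ a b => by
    simp only [X, Finset.pair_comm a b, ne_comm (a := a)]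
  let f : T × Fin 4 × Fin 4 × Fin 4 → ℝ := fun z => ((o z.1 : ℤ) : ℝ) *
    ((orderSign z.2.1 z.2.2.1 z.2.2.2 : ℝ) * X z.1 z.2.1 z.2.2.1 *
      (x.1 (z.1, z.2.1) + x.2 (z.1, quadPairing z.2.1 z.2.2.2)))
  have hf : ∀ z, f (τ.cross z) = -f z := by
    rintro ⟨σ, a, b, d⟩
    by_cases h0 : orderSign a b d = 0
    · simp [f, cross, h0, orderSign_perm]
    obtain ⟨hab, had, hbd⟩ := orderSign_ne_zero a b d h0
    have hg : Function.Injective (τ.glue σ d) := (τ.glue σ d).injective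
    have h1 : X (τ.adj σ d) (τ.glue σ d a) (τ.glue σ d b) = X σ a b := by
      simp only [X, dif_pos hab, dif_pos (hg.ne hab)]
      refine (hχ _ _ ⟨d, ?_, rfl, ?_⟩).symm
      · simp [had.symm, hbd.symm]
      · simp
    have h2 := hx σ d a had _ _ ((quadHasArc_iff _ _ _ had).2 rfl)
      ((quadHasArc_iff _ _ _ (hg.ne had)).2 rfl)
    have h3 : ((o (τ.adj σ d) : ℤ) : ℝ) * ((Equiv.Perm.sign (τ.glue σ d) : ℤ) : ℝ) =
        -((o σ : ℤ) : ℝ) := by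
      have hod := congrArg (fun u : ℤˣ => ((u : ℤ) : ℝ)) (ho σ d)
      have hsq : ((o σ : ℤ) : ℝ) * ((o σ : ℤ) : ℝ) = 1 := by
        rcases Int.units_eq_one_or (o σ) with h | h <;> simp [h]
      push_cast at hod
      linear_combination ((o σ : ℤ) : ℝ) * hod -
        ((o (τ.adj σ d) : ℤ) : ℝ) * ((Equiv.Perm.sign (τ.glue σ d) : ℤ) : ℝ) * hsq
    simp only [f, cross, h1, orderSign_perm]
    push_cast
    rw [h2, add_comm (x.1 _)]
    linear_combination (orderSign a b d : ℝ) * X σ a b *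
      (x.2 (τ.adj σ d, quadPairing (τ.glue σ d a) (τ.glue σ d d)) +
        x.1 (τ.adj σ d, τ.glue σ d a)) * h3
  have hsum : ∑ z, f z = 0 := by
    have h := Equiv.sum_comp τ.cross_involutive.toPerm f
    simp only [Function.Involutive.coe_toPerm, hf, Finset.sum_neg_distrib] at h
    linarith
  have hσ : ∀ (σ : T), ∑ k : Fin 3, (τ.index e (σ, k) : ℝ) * rotate o x.2 (σ, k) =
      -(1 / 2) * ∑ a, ∑ b, ∑ d, f (σ, a, b, d) := by
    intro σ
    simp only [f, ← Finset.mul_sum]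
    rw [sum_orderSign_mul (X σ) (hX σ) (fun a => x.1 (σ, a)) (fun k => x.2 (σ, k)),
      mul_left_comm, ← mul_assoc, ← mul_assoc, Finset.mul_sum]
    refine Finset.sum_congr rfl fun k _ => ?_
    have hi : (τ.index e (σ, k) : ℝ) = X σ 0 k.succ + X σ (k + 1).succ (k + 2).succ := by
      have hne : (k + 1).succ ≠ (k + 2).succ := by revert k; decide
      rw [index_eq_sum, sum_mul_tetEdgeIndex χ, ← Finset.sum_filter, filter_sameSide,
        Finset.sum_pair]
      · simp [X, (Fin.succ_ne_zero k).symm, hne]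
      · revert k; decide
    rw [hi, rotate]
    ring
  rw [Fintype.sum_prod_type]
  simp only [hσ, ← Finset.mul_sum]
  simp only [Fintype.sum_prod_type] at hsum
  rw [hsum, mul_zero]

end FacePairing

/-! ### Flat angles at a maximum of the volume -/

/-- The points of the circle at which the volume is not smooth. -/
def IsFlat (z : Circle) : Prop :=
  (z : ℂ) = 1 ∨ (z : ℂ) = -1

theorem isFlat_iff {z : Circle} : IsFlat z ↔ z = 1 ∨ z = -1 := by
  simp [IsFlat, Circle.ext_iff]

theorem sin_arg_ne_zero {z : Circle} (hz : ¬ IsFlat z) : Real.sin (Complex.arg z) ≠ 0 := by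
  intro h
  have hexp : (z : ℂ) = Complex.exp (Complex.arg z * Complex.I) := by
    rw [← Circle.coe_exp, Circle.exp_arg]
  rw [Complex.exp_mul_I, ← Complex.ofReal_cos, ← Complex.ofReal_sin, h] at hexp
  refine hz ?_
  rcases Real.sin_eq_zero_iff_cos_eq.1 h with hc | hc
  · left; rw [hexp, hc]; simp
  · right; rw [hexp, hc]; simp

theorem circleLobachevsky_mul_of_isFlat {z : Circle} (hz : IsFlat z) (w : Circle) :
    circleLobachevsky (z * w) = circleLobachevsky w := by
  rcases isFlat_iff.1 hz with rfl | rfl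
  · rw [one_mul]
  · rw [neg_one_mul, circleLobachevsky_neg]

theorem circleLobachevsky_one : circleLobachevsky 1 = 0 := by
  rw [← Circle.exp_zero, circleLobachevsky_exp, lobachevsky_zero]

theorem circleLobachevsky_of_isFlat {z : Circle} (hz : IsFlat z) : circleLobachevsky z = 0 := by
  rw [← mul_one z, circleLobachevsky_mul_of_isFlat hz, circleLobachevsky_one]

/-- A tetrahedron with a flat angle has volume zero, whatever its other angles are. -/
theorem sum_circleLobachevsky_of_isFlat {x : Fin 3 → Circle} (h : ∏ k, x k = -1) {k : Fin 3}
    (hk : IsFlat (x k)) : ∑ k, circleLobachevsky (x k) = 0 := by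
  have key : ∀ a b c : Circle, IsFlat a → a * b * c = -1 →
      circleLobachevsky a + circleLobachevsky b + circleLobachevsky c = 0 := by
    intro a b c ha habc
    rw [← circleLobachevsky_mul_of_isFlat ha b, circleLobachevsky_of_isFlat ha, zero_add,
      eq_mul_inv_of_mul_eq habc, neg_one_mul, circleLobachevsky_neg, circleLobachevsky_inv,
      neg_add_cancel]
  rw [Fin.prod_univ_three] at h
  rw [Fin.sum_univ_three]
  fin_cases k
  · exact key _ _ _ hk h
  · linarith [key (x 1) (x 0) (x 2) hk (by rw [mul_comm (x 1), h])]
  · linarith [key (x 2) (x 0) (x 1) hk (by rw [← h]; exact mul_rotate _ _ _)]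

theorem isFlat_of_two {x : Fin 3 → Circle} (h : ∏ k, x k = -1) {k m : Fin 3} (hkm : k ≠ m)
    (hk : IsFlat (x k)) (hm : IsFlat (x m)) (j : Fin 3) : IsFlat (x j) := by
  have key : ∀ a b c : Circle, IsFlat a → IsFlat b → a * b * c = -1 → IsFlat c := by
    intro a b c ha hb habc
    rw [isFlat_iff] at *
    rcases ha with rfl | rfl <;> rcases hb with rfl | rfl <;> simp at habc <;> simp [habc]
  rw [Fin.prod_univ_three] at h
  have h1 : x 1 * x 2 * x 0 = -1 := by rw [← h]; exact (mul_rotate _ _ _).symm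
  have h2 : x 2 * x 0 * x 1 = -1 := by rw [← h]; exact mul_rotate _ _ _
  have h0 := key (x 0) (x 1) (x 2)
  have h1' := key (x 1) (x 2) (x 0)
  have h2' := key (x 2) (x 0) (x 1)
  fin_cases k <;> fin_cases m <;> fin_cases j <;> simp_all

theorem Circle.exp_sum {ι : Type*} (s : Finset ι) (f : ι → ℝ) :
    Circle.exp (∑ i ∈ s, f i) = ∏ i ∈ s, Circle.exp (f i) := by
  classical
  induction s using Finset.induction_on with
  | empty => simp
  | insert a s ha ih => rw [Finset.sum_insert ha, Finset.prod_insert ha, Circle.exp_add, ih]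

theorem mul_mul_log_mul (t v : ℝ) :
    t * v * Real.log (t * v) = v * (t * Real.log t) + t * (v * Real.log v) := by
  by_cases ht : t = 0
  · simp [ht]
  by_cases hv : v = 0
  · simp [hv]
  rw [Real.log_mul ht hv]
  ring

namespace FacePairing

variable {T : Type*} (τ : FacePairing T) [Fintype T]

variable {τ} in
theorem prod_eq_neg_one {p : NormalQuad T → Circle} (hp : p ∈ τ.SAS) (σ : T) :
    ∏ k : Fin 3, p (σ, k) = -1 := by
  ext
  simpa [Fin.prod_univ_three] using hp.1 σ

variable {τ} in
theorem mul_exp_mem_SAS {p v} (hp : p ∈ τ.SAS) (hv : v ∈ τ.tas) :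
    (fun q => p q * Circle.exp (v q)) ∈ τ.SAS := by
  refine ⟨fun σ => ?_, fun e => ?_⟩
  · have h : ∏ k : Fin 3, (p (σ, k) * Circle.exp (v (σ, k))) = -1 := by
      rw [Finset.prod_mul_distrib, prod_eq_neg_one hp, ← Circle.exp_sum, hv.1 σ, Circle.exp_zero,
        mul_one]
    have := congrArg (Subtype.val) h
    simpa [Fin.prod_univ_three] using this
  · have h : ∀ q, Circle.exp (v q) ^ τ.index e q = Circle.exp (τ.index e q * v q) := fun q => by
      rw [← nsmul_eq_mul, Circle.exp_nsmul]
    simp only [mul_pow, Finset.prod_mul_distrib, hp.2 e, h, ← Circle.exp_sum, hv.2 e,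
      Circle.exp_zero, mul_one]

open Classical in
/-- First order conditions at a maximum of the volume: along a tangent vector `v` the volume varies
by `-(∑ v_q) t log |t| + t (ℓ(v) - ∑ v_q log |v_q|) + o(t)`, where the sums are over the
flat angles and `ℓ` is linear. -/
theorem exists_sum_mul_log_eq {p : NormalQuad T → Circle} (hp : p ∈ τ.SAS)
    (hmax : IsMaxOn angleVolume τ.SAS p) :
    ∃ ℓ : Module.Dual ℝ (NormalQuad T → ℝ), ∀ v ∈ τ.tas,
      ∑ q ∈ Finset.univ.filter (fun q => IsFlat (p q)), v q * Real.log (v q) = ℓ v := by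
  set F : Finset (NormalQuad T) := Finset.univ.filter (fun q => IsFlat (p q)) with hF
  let θ : NormalQuad T → ℝ := fun q => Complex.arg (p q)
  let A : (NormalQuad T → ℝ) → ℝ := fun v => ∑ q ∈ F, v q
  let B : (NormalQuad T → ℝ) → ℝ := fun v => ∑ q ∈ F, v q * Real.log (v q)
  let ψ : ℝ → ℝ := fun s => lobachevsky s + s * Real.log s
  let D : (NormalQuad T → ℝ) → ℝ → ℝ := fun v t => ∑ q ∈ F, ψ (t * v q) +
    ∑ q ∈ Fᶜ, (lobachevsky (θ q + t * v q) - lobachevsky (θ q)) - t * B v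
  let K : (NormalQuad T → ℝ) → ℝ := fun v => ∑ q ∈ F, (1 - Real.log 2) * v q +
    ∑ q ∈ Fᶜ, (-Real.log |2 * Real.sin (θ q)|) * v q - B v
  have hD0 : ∀ v, D v 0 = 0 := fun v => by simp [D, ψ, lobachevsky_zero]
  have hDK : ∀ v, HasDerivAt (D v) (K v) 0 := by
    intro v
    have hlin : ∀ q, HasDerivAt (fun t : ℝ => t * v q) (v q) 0 := fun q => by
      simpa using (hasDerivAt_id (0 : ℝ)).mul_const (v q)
    have h1 : ∀ q, HasDerivAt (fun t => ψ (t * v q)) ((1 - Real.log 2) * v q) 0 := fun q => by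
      have h0 : HasDerivAt ψ (1 - Real.log 2) (0 * v q) := by
        rw [zero_mul]
        exact hasDerivAt_lobachevsky_add_mul_log
      exact h0.comp (0 : ℝ) (hlin q)
    have h2 : ∀ q ∈ Fᶜ, HasDerivAt (fun t => lobachevsky (θ q + t * v q) - lobachevsky (θ q))
        (-Real.log |2 * Real.sin (θ q)| * v q) 0 := fun q hq => by
      have h0 : HasDerivAt lobachevsky (-Real.log |2 * Real.sin (θ q)|) (θ q + 0 * v q) := by
        rw [zero_mul, add_zero]
        exact hasDerivAt_lobachevsky (sin_arg_ne_zero (by simpa [hF] using hq))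
      exact (h0.comp (0 : ℝ) ((hlin q).const_add (θ q))).sub_const _
    have h3 : HasDerivAt (fun t : ℝ => t * B v) (B v) 0 := by
      simpa using (hasDerivAt_id (0 : ℝ)).mul_const (B v)
    exact ((HasDerivAt.fun_sum fun q _ => h1 q).add (HasDerivAt.fun_sum h2)).sub h3
  have hle : ∀ v ∈ τ.tas, ∀ t, D v t ≤ A v * (t * Real.log t) := by
    intro v hv t
    have h := isMaxOn_iff.1 hmax _ (mul_exp_mem_SAS hp (τ.tas.smul_mem t hv))
    simp only [angleVolume, Pi.smul_apply, smul_eq_mul] at h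
    rw [← Finset.sum_add_sum_compl F, ← Finset.sum_add_sum_compl F fun q => circleLobachevsky (p q)]
      at h
    have h1 : ∑ q ∈ F, circleLobachevsky (p q * Circle.exp (t * v q)) =
        ∑ q ∈ F, ψ (t * v q) - A v * (t * Real.log t) - t * B v := by
      simp only [A, B, Finset.sum_mul, Finset.mul_sum, ← Finset.sum_sub_distrib]
      refine Finset.sum_congr rfl fun q hq => ?_
      rw [circleLobachevsky_mul_of_isFlat (Finset.mem_filter.1 hq).2, circleLobachevsky_exp]
      simp only [ψ, mul_mul_log_mul]
      ring
    have h2 : ∑ q ∈ Fᶜ, circleLobachevsky (p q * Circle.exp (t * v q)) =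
        ∑ q ∈ Fᶜ, lobachevsky (θ q + t * v q) := by
      refine Finset.sum_congr rfl fun q _ => ?_
      rw [← circleLobachevsky_exp, Circle.exp_add, Circle.exp_arg]
    have h3 : ∑ q ∈ F, circleLobachevsky (p q) = 0 :=
      Finset.sum_eq_zero fun q hq => circleLobachevsky_of_isFlat (Finset.mem_filter.1 hq).2
    have h4 : ∑ q ∈ Fᶜ, circleLobachevsky (p q) = ∑ q ∈ Fᶜ, lobachevsky (θ q) := rfl
    rw [h1, h2, h3, h4] at h
    simp only [D, Finset.sum_sub_distrib]
    linarith
  have hA : ∀ v ∈ τ.tas, A v = 0 := by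
    intro v hv
    have h1 := nonpos_of_le_mul_mul_log (hDK v) (hD0 v) (hle v hv)
    have h2 := nonpos_of_le_mul_mul_log (hDK (-v)) (hD0 (-v)) (hle (-v) (τ.tas.neg_mem hv))
    have h3 : A (-v) = -A v := by simp [A]
    linarith
  refine ⟨∑ q ∈ F, (1 - Real.log 2) • LinearMap.proj q +
    ∑ q ∈ Fᶜ, (-Real.log |2 * Real.sin (θ q)|) • LinearMap.proj q, fun v hv => ?_⟩
  have hloc : IsLocalMax (D v) 0 := Filter.Eventually.of_forall fun t => by
    rw [hD0]
    simpa [hA v hv] using hle v hv t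
  have hK := hloc.hasDerivAt_eq_zero (hDK v)
  simp only [K, B] at hK
  simp only [LinearMap.add_apply, LinearMap.sum_apply, LinearMap.smul_apply, LinearMap.proj_apply,
    smul_eq_mul]
  linarith

/-- At a maximum of the volume each flat angle gives a solution of Haken's equation whose only
non-zero quadrilateral coordinates are at this angle and at most one other flat angle. -/
theorem exists_solution_of_isFlat {p : NormalQuad T → Circle} (hp : p ∈ τ.SAS)
    (hmax : IsMaxOn angleVolume τ.SAS p) {q : NormalQuad T} (hq : IsFlat (p q)) :
    ∃ r x, IsFlat (p r) ∧ τ.IsHakenSolution x ∧ x.2 q ≠ 0 ∧ ∀ s, x.2 s ≠ 0 → s = q ∨ s = r := by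
  classical
  obtain ⟨ℓ, hℓ⟩ := τ.exists_sum_mul_log_eq hp hmax
  obtain ⟨r, y, hr, hy, hyq, hys⟩ : ∃ (r : NormalQuad T) (y : NormalQuad T → ℝ), IsFlat (p r) ∧
      (∀ v ∈ τ.tas, ∑ s, y s * v s = 0) ∧ y q ≠ 0 ∧ ∀ s, y s ≠ 0 → s = q ∨ s = r := by
    rcases exists_eq_smul_of_sum_mul_log_linear τ.tas _ (fun q => LinearMap.proj q) ℓ hℓ
      (Finset.mem_filter.2 ⟨Finset.mem_univ q, hq⟩) with h | ⟨r, hr, hrq, c, h⟩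
    · refine ⟨q, Pi.single q 1, hq, fun v hv => ?_, by simp, fun s hs => ?_⟩
      · simpa [Pi.single_apply] using h v hv
      · left
        by_contra hsq
        simp [hsq] at hs
    · refine ⟨r, Pi.single q 1 - c • Pi.single r 1, (Finset.mem_filter.1 hr).2, fun v hv => ?_, ?_,
        fun s hs => ?_⟩
      · have := h v hv
        simp only [LinearMap.proj_apply] at this
        simp [Pi.single_apply, sub_mul, Finset.sum_sub_distrib, this]
      · simp [hrq.symm]
      · by_contra! hcon
        simp [hcon.1, hcon.2] at hs
  obtain ⟨a, β, hβ, hyβ⟩ := τ.exists_of_forall_tas y hy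
  obtain ⟨x, hx, hxβ⟩ := τ.exists_isHakenSolution a β hβ
  have hxy : x.2 = y := funext fun ⟨σ, k⟩ => by rw [hxβ, hyβ]
  exact ⟨r, x, hr, hx, hxy ▸ hyq, hxy ▸ hys⟩

/-- A non-smooth maximum can be moved, with constant volume, to one with a completely flat
tetrahedron: rotating the solution attached to a flat angle gives a direction which keeps all flat
angles of the tetrahedra it moves. -/
theorem exists_max_all_isFlat {o : T → ℤˣ} (ho : τ.IsOrientation o) {p : NormalQuad T → Circle}
    (hp : p ∈ τ.SAS) (hmax : IsMaxOn angleVolume τ.SAS p) {q : NormalQuad T}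
    (hq : IsFlat (p q)) :
    ∃ p' ∈ τ.SAS, IsMaxOn angleVolume τ.SAS p' ∧ ∃ σ, ∀ k, IsFlat (p' (σ, k)) := by
  by_cases hall : ∃ σ, ∀ k, IsFlat (p (σ, k))
  · exact ⟨p, hp, hmax, hall⟩
  obtain ⟨σ, k⟩ := q
  obtain ⟨⟨ρ, m⟩, x, hr, hx, hxq, hxs⟩ := τ.exists_solution_of_isFlat hp hmax hq
  -- two flat angles in one tetrahedron force the third
  have hρ : ρ = σ → m = k := by
    rintro rfl
    by_contra hmk
    exact hall ⟨ρ, isFlat_of_two (prod_eq_neg_one hp ρ) hmk hr hq⟩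
  have hk1 : ∀ j : Fin 3, j + 1 ≠ j := by decide
  have hk2 : ∀ j : Fin 3, j + 2 ≠ j := by decide
  have hxσ : ∀ j, j ≠ k → x.2 (σ, j) = 0 := by
    intro j hj
    by_contra h
    rcases hxs _ h with h | h
    · exact hj (Prod.ext_iff.1 h).2
    · obtain ⟨h1, h2⟩ := Prod.ext_iff.1 h
      exact hj ((h2 : j = m).trans (hρ h1.symm))
  have hxρ : ∀ j, j ≠ m → x.2 (ρ, j) = 0 := by
    intro j hj
    by_contra h
    rcases hxs _ h with h | h
    · obtain ⟨h1, h2⟩ := Prod.ext_iff.1 h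
      exact hj ((h2 : j = k).trans (hρ h1).symm)
    · exact hj (Prod.ext_iff.1 h).2
  have hx0 : ∀ σ', σ' ≠ σ → σ' ≠ ρ → ∀ j, x.2 (σ', j) = 0 := by
    intro σ' h1 h2 j
    by_contra h
    rcases hxs _ h with h | h
    · exact h1 (Prod.ext_iff.1 h).1
    · exact h2 (Prod.ext_iff.1 h).1
  let v := rotate o x.2
  have hv : v ∈ τ.tas := τ.rotate_mem_tas ho hx
  have hvσ : v (σ, k) = 0 := by
    simp [v, rotate, hxσ _ (hk1 k), hxσ _ (hk2 k)]
  have hvρ : v (ρ, m) = 0 := by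
    simp [v, rotate, hxρ _ (hk1 m), hxρ _ (hk2 m)]
  have hv1 : v (σ, k + 1) ≠ 0 := by
    have e1 : ∀ j : Fin 3, j + 1 + 1 = j + 2 := by decide
    have e2 : ∀ j : Fin 3, j + 1 + 2 = j := by decide
    simp [v, rotate, e1, e2, hxσ _ (hk2 k), hxq]
  have hv0 : ∀ σ', σ' ≠ σ → σ' ≠ ρ → ∀ j, v (σ', j) = 0 := by
    intro σ' h1 h2 j
    simp [v, rotate, hx0 σ' h1 h2]
  -- the time at which the angle next to the flat one becomes trivial
  let t : ℝ := -Complex.arg (p (σ, k + 1)) / v (σ, k + 1)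
  let p' : NormalQuad T → Circle := fun s => p s * Circle.exp ((t • v) s)
  have hp' : p' ∈ τ.SAS := mul_exp_mem_SAS hp (τ.tas.smul_mem t hv)
  have hpσ : IsFlat (p' (σ, k)) := by simpa [p', hvσ] using hq
  have hpρ : IsFlat (p' (ρ, m)) := by simpa [p', hvρ] using hr
  have hp1 : p' (σ, k + 1) = 1 := by
    have : (t • v) (σ, k + 1) = -Complex.arg (p (σ, k + 1)) := by
      simp only [t, Pi.smul_apply, smul_eq_mul]
      field_simp
    simp only [p', this]
    rw [Circle.exp_neg, Circle.exp_arg, mul_inv_cancel]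
  have hvol : angleVolume p' = angleVolume p := by
    simp only [angleVolume, Fintype.sum_prod_type]
    refine Finset.sum_congr rfl fun σ' _ => ?_
    by_cases h1 : σ' = σ
    · subst h1
      rw [sum_circleLobachevsky_of_isFlat (prod_eq_neg_one hp' σ') hpσ,
        sum_circleLobachevsky_of_isFlat (prod_eq_neg_one hp σ') hq]
    by_cases h2 : σ' = ρ
    · subst h2
      rw [sum_circleLobachevsky_of_isFlat (prod_eq_neg_one hp' σ') hpρ,
        sum_circleLobachevsky_of_isFlat (prod_eq_neg_one hp σ') hr]
    · simp [p', hv0 σ' h1 h2]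
  refine ⟨p', hp', isMaxOn_iff.2 fun z hz => ?_, σ, ?_⟩
  · rw [hvol]
    exact isMaxOn_iff.1 hmax z hz
  · exact isFlat_of_two (prod_eq_neg_one hp' σ) (hk1 k).symm hpσ (isFlat_iff.2 (Or.inl hp1))

end FacePairing

theorem theorem4p6 {T : Type*} [Fintype T] (τ : FacePairing T)
    (o : T → ℤˣ) (ho : τ.IsOrientation o)
    (hmax : ∃ p ∈ τ.SAS, IsMaxOn angleVolume τ.SAS p ∧ IsNonSmooth p) :
    ∃ (σ : T) (x : Fin 3 → (NormalTriangle T → ℝ) × (NormalQuad T → ℝ))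
      (q : Fin 3 → NormalQuad T),
      (∀ i, τ.IsTwoQuadSolution (x i)) ∧ Function.Injective x ∧
      Function.Injective q ∧ (∀ i, (q i).1 = σ) ∧
      ∀ i, (x i).2 (q i) ≠ 0 := by
  obtain ⟨p₀, hp₀, hmax₀, q₀, hq₀⟩ := hmax
  obtain ⟨p, hp, hmax, σ, hσ⟩ := τ.exists_max_all_isFlat ho hp₀ hmax₀ hq₀
  choose r y _ hy hyq hys using fun k => τ.exists_solution_of_isFlat hp hmax (hσ k)
  have hy0 : ∀ k, ‖y k‖ ≠ 0 := fun k h => hyq k (by rw [norm_eq_zero.1 h]; rfl)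
  -- solutions attached to different quadrilaterals may coincide: normalize them to have
  -- different norms
  let c : Fin 3 → ℝ := fun k => (k.val + 1) / ‖y k‖
  have hc : ∀ k, c k ≠ 0 := fun k => div_ne_zero (by positivity) (hy0 k)
  have hsupp : ∀ k, {q | (c k • y k).2 q ≠ 0} = {q | (y k).2 q ≠ 0} := fun k => by
    ext q
    simp [hc k]
  refine ⟨σ, fun k => c k • y k, fun k => (σ, k), fun k => ⟨(hy k).smul _, ?_⟩, ?_, ?_,
    fun _ => rfl, fun k => ?_⟩
  · rw [hsupp]
    have hsub : {q | (y k).2 q ≠ 0} ⊆ {(σ, k), r k} := fun s hs => hys k s hs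
    have h2 := (Set.ncard_le_ncard hsub (Set.toFinite _)).trans (Set.ncard_insert_le _ _)
    rw [Set.ncard_singleton] at h2
    have h1 : 0 < {q | (y k).2 q ≠ 0}.ncard := (Set.ncard_pos (Set.toFinite _)).2 ⟨_, hyq k⟩
    omega
  · intro k m hkm
    have hn : ∀ k, ‖c k • y k‖ = k.val + 1 := fun k => by
      rw [norm_smul, Real.norm_of_nonneg (by positivity), div_mul_cancel₀ _ (hy0 k)]
    have h := congrArg norm hkm
    simp only [hn] at h
    exact Fin.ext (by exact_mod_cast add_right_cancel h)
  · exact fun k m h => (Prod.ext_iff.1 h).2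
  · simpa [hc k] using hyq k
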